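/- Let $G$ be a compact Lie group with Lie algebra $\mathfrak g$, let $\eta\in\mathfrak g^*$, let $\mathcal O=\mathcal O_\eta=\{g\cdot\eta : g\in G\}\cong G/G_\eta$ be its orbit under the coadjoint action $(g\cdot\nu)(A)=\nu(\mathrm{Ad}_{g^{-1}}A)$, and let $G_\eta$ be the isotropy group of $\eta$. Assume that there is given a character $\Lambda:G_\eta\to U(1)$ whose derivative is $C\mapsto 2\pi i\,\eta(C)$. Let $L=G\times_\Lambda\mathbb C=(G\times\mathbb C)/\simeq$, where $(g,z)\simeq(gb^{-1},\Lambda(b)z)$ for $b\in G_\eta$, be the associated complex line bundle over $\mathcal O$, with projection $[g,z]\mapsto g\cdot\eta$, and let $L^\times=L\setminus\{\text{zero section}\}$. Equip $L$ with the connection $D$ given by the form $\Omega$ on $L^\times$ whose pull-back to $G\times\mathbb C^\times$ is $\theta+\frac{1}{2\pi i}\frac{dz}{z}$, where $\theta$ is the left-invariant $1$-form on $G$ with value $\eta$ at the identity. That is, a section $\sigma$ defines a function $\sigma^\sharp$ on $L^\times$ by $\sigma(\pi(y))=\sigma^\sharp(y)\,y$, and $(D_X\sigma)^\sharp=X^\sharp(\sigma^\sharp)$,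 where $X^\sharp$ is the lift of the vector field $X$ to $L^\times$ annihilated by $\Omega$. For $A\in\mathfrak g$ let $X_A$ be the vector field on $\mathcal O$ generated by $A$, i.e. $X_A(\nu)=\frac{d}{du}\big|_{u=0}e^{uA}\cdot\nu$, let $f_A(\nu)=-\nu(A)$ be its Hamiltonian (so $\iota_{X_A}\omega=-df_A$ for $\omega_\nu(X_A,X_B)=\nu([A,B])$), and let $$\mathcal P_A=-D_{X_A}-2\pi i f_A$$ be the prequantization operator on the space $C^\infty(L)$ of smooth sections of $L$. Let $\mathcal E_\Lambda$ be the space of smooth functions $s:G\to\mathbb C$ such that $s(gb^{-1})=\Lambda(b)s(g)$ for all $g\in G$, $b\in G_\eta$. Theorem. The relation $\sigma(g\cdot\eta)=[g,s(g)]$ $(g\in G)$ defines a linear isomorphism $C^\infty(L)\to\mathcal E_\Lambda$, $\sigma\mapsto s$. For every $A\in\mathfrak g$ and $\sigma\in C^\infty(L)$ the covariant derivative $D_{X_A}\sigma$ exists and is unique, and $\mathcal P_A$ is a linear endomorphism of $C^\infty(L)$. Under the isomorphism, the action of $\mathcal P_A$ on $\mathcal E_\Lambda$ is $$\mathcal P_A(s)=-R_A(s)\qquad(A\in\mathfrak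 g,\ s\in\mathcal E_\Lambda),$$ where $R_A$ is the right-invariant vector field on $G$ with value $A$ at the identity. -/

import Mathlib

open scoped Manifold ContDiff

noncomputable section

namespace CoadjointOrbit

section Coadjoint

variable {E : Type*} [NormedAddCommGroup E] [NormedSpace ℝ E]
  {H : Type*} [TopologicalSpace H] (I : ModelWithCorners ℝ E H)
  {G : Type*} [TopologicalSpace G] [ChartedSpace H G] [Group G]

/-- The differential at `1` of the conjugation `a ↦ g * a * g⁻¹`, that is `Ad g : 𝔤 → 𝔤`.
The Lie algebra `𝔤 = T₁G` is, by definition of the tangent space, the model space `E`. -/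
def Ad (g : G) : E →L[ℝ] E :=
  mfderiv I I (fun a : G => g * a * g⁻¹) (1 : G)

/-- The dual `𝔤*` of the Lie algebra `𝔤 = T₁G` (which is the model space `E`). -/
abbrev LieDual (E : Type*) [NormedAddCommGroup E] [NormedSpace ℝ E] : Type _ := E →L[ℝ] ℝ

/-- The coadjoint action `(g · ν)(A) = ν(Ad g⁻¹ A)`. -/
def coAd (g : G) (ν : LieDual E) : LieDual E := ν.comp (Ad I g⁻¹)

theorem Ad_one : Ad I (1 : G) = ContinuousLinearMap.id ℝ E := by
  have h : (fun a : G => (1 : G) * a * (1 : G)⁻¹) = id := by ext a; simp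
  unfold Ad
  rw [h]
  exact mfderiv_id

theorem coAd_one (ν : LieDual E) : coAd I (1 : G) ν = ν := by
  ext x; simp [coAd, Ad_one]

variable [LieGroup I ∞ G]

theorem mdifferentiableAt_conj (g a : G) :
    MDifferentiableAt I I (fun a : G => g * a * g⁻¹) a := by
  have h : ContMDiff I I ∞ (fun a : G => g * a * g⁻¹) :=
    (contMDiff_mul_right (a := g⁻¹)).comp (contMDiff_mul_left (a := g))
  exact h.contMDiffAt.mdifferentiableAt (by simp)

theorem Ad_mul (g h : G) : Ad I (g * h) = (Ad I g).comp (Ad I h) := by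
  have e : (fun a : G => g * h * a * (g * h)⁻¹)
      = (fun a : G => g * a * g⁻¹) ∘ (fun a : G => h * a * h⁻¹) := by
    ext a; simp [mul_assoc]
  have h1 : h * 1 * h⁻¹ = (1 : G) := by simp
  have key := mfderiv_comp (I := I) (I' := I) (I'' := I) (1 : G)
    (mdifferentiableAt_conj I g (h * 1 * h⁻¹)) (mdifferentiableAt_conj I h 1)
  unfold Ad
  rw [e]
  refine key.trans ?_
  have : ∀ x : G, x = 1 →
      (mfderiv I I (fun a : G => g * a * g⁻¹) x : E →L[ℝ] E)
        = mfderiv I I (fun a : G => g * a * g⁻¹) (1 : G) := by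
    rintro x rfl; rfl
  exact congrArg (fun T : E →L[ℝ] E =>
    T.comp (mfderiv I I (fun a : G => h * a * h⁻¹) (1 : G) : E →L[ℝ] E)) (this _ h1)

theorem coAd_mul (g h : G) (ν : LieDual E) : coAd I (g * h) ν = coAd I g (coAd I h ν) := by
  ext x; simp [coAd, Ad_mul]

end Coadjoint

section Orbit

variable {E : Type*} [NormedAddCommGroup E] [NormedSpace ℝ E]
  {H : Type*} [TopologicalSpace H] (I : ModelWithCorners ℝ E H)
  (G : Type*) [TopologicalSpace G] [ChartedSpace H G] [Group G] [LieGroup I ∞ G]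
  (η : LieDual E)

/-- The isotropy subgroup `G_η` of `η` for the coadjoint action. -/
def isotropy : Subgroup G where
  carrier := {g | coAd I g η = η}
  one_mem' := coAd_one I η
  mul_mem' := by
    intro a b ha hb
    have ha' : coAd I a η = η := ha
    have hb' : coAd I b η = η := hb
    show coAd I (a * b) η = η
    rw [coAd_mul, hb', ha']
  inv_mem' := by
    intro a ha
    have ha' : coAd I a η = η := ha
    show coAd I a⁻¹ η = η
    conv_lhs => rw [← ha']
    rw [← coAd_mul, inv_mul_cancel, coAd_one]

/-- The coadjoint orbit `𝓞_η`, a subset of `𝔤*`. -/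
def orbit : Set (LieDual E) := Set.range fun g : G => coAd I g η

variable {G}

/-- The projection `G → 𝓞_η`, `g ↦ g · η`, which identifies `G / G_η` with `𝓞_η`. -/
def orbitMap (g : G) : orbit I G η := ⟨coAd I g η, g, rfl⟩

variable {I η} in
theorem orbitMap_eq_iff {g g' : G} :
    orbitMap I η g = orbitMap I η g' ↔ g⁻¹ * g' ∈ isotropy I G η := by
  have : (g⁻¹ * g' ∈ isotropy I G η) ↔ coAd I (g⁻¹ * g') η = η := Iff.rfl
  have h2 : orbitMap I η g = orbitMap I η g' ↔ coAd I g η = coAd I g' η := Subtype.ext_iff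
  rw [this, coAd_mul, h2]
  constructor
  · intro h
    rw [← h, ← coAd_mul, inv_mul_cancel, coAd_one]
  · intro h
    conv_lhs => rw [← h]
    rw [← coAd_mul, mul_inv_cancel, coAd_one]

/-- The value at `ν ∈ 𝔤*` of the vector field `X_A` generated by `A` : the derivative at `1`,
in the direction `A`, of `a ↦ a · ν`. -/
def fundamentalVector (A : GroupLieAlgebra I G) (ν : LieDual E) : LieDual E :=
  mfderiv I 𝓘(ℝ, LieDual E) (fun a : G => coAd I a ν) (1 : G) A

variable (G) in
/-- The tangent space `T_p 𝓞_η = {X_A(p) | A ∈ 𝔤} ⊆ 𝔤*` of the orbit. -/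
def orbitTangent (p : orbit I G η) : Submodule ℝ (LieDual E) :=
  LinearMap.range
    (mfderiv I 𝓘(ℝ, LieDual E) (fun a : G => coAd I a p.1) (1 : G) : E →L[ℝ] LieDual E).toLinearMap

/-- The vector field `X_A` on the orbit. -/
def fundamentalField (A : GroupLieAlgebra I G) (p : orbit I G η) : orbitTangent I G η p :=
  ⟨fundamentalVector I A p.1, A, rfl⟩

/-- The differential at `g` of `G → 𝓞_η ⊆ 𝔤*`. -/
def orbitMapDeriv (g : G) (V : TangentSpace I g) : LieDual E :=
  mfderiv I 𝓘(ℝ, LieDual E) (fun a : G => coAd I a η) g V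

/-- The Hamiltonian `f_A(ν) = -ν(A)` of `X_A`: for the symplectic form
`ω_ν(X_A, X_B) = ν([A, B])` one has `ι_{X_A} ω = -d f_A`. -/
def hamiltonian (A : GroupLieAlgebra I G) (p : orbit I G η) : ℝ := -(p.1 A)

variable {I η} in
/-- The derivative of the character `Λ` of `G_η` is `C ↦ 2πi η(C)`: along each smooth curve germ
`c` in `G_η` with `c(0) = 1`, the derivative of `Λ ∘ c` at `0` is `2πi η(c'(0))`. -/
def HasDifferential (Λ : isotropy I G η →ₜ* Circle) : Prop :=
  ∀ c : ℝ → isotropy I G η, c 0 = 1 →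
    ContMDiffAt 𝓘(ℝ, ℝ) I ∞ (fun t => (c t : G)) 0 →
    HasDerivAt (fun t => (Λ (c t) : ℂ))
      (2 * Real.pi * Complex.I *
        ((η (mfderiv 𝓘(ℝ, ℝ) I (fun t => (c t : G)) 0 (1 : ℝ) : E) : ℝ) : ℂ)) 0

end Orbit

section LineBundle

variable {E : Type*} [NormedAddCommGroup E] [NormedSpace ℝ E]
  {H : Type*} [TopologicalSpace H] {I : ModelWithCorners ℝ E H}
  {G : Type*} [TopologicalSpace G] [ChartedSpace H G] [Group G] [LieGroup I ∞ G]
  {η : LieDual E} (Λ : isotropy I G η →ₜ* Circle)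

/-- The relation `(g, z) ≃ (g b⁻¹, Λ(b) z)`, `b ∈ G_η`, on `G × ℂ`. -/
def bundleSetoid : Setoid (G × ℂ) where
  r x y := ∃ b : isotropy I G η, y = (x.1 * (b : G)⁻¹, (Λ b : ℂ) * x.2)
  iseqv :=
    { refl := fun x => ⟨1, by simp⟩
      symm := by
        rintro x y ⟨b, rfl⟩
        exact ⟨b⁻¹, by ext <;> simp⟩
      trans := by
        rintro x y z ⟨b, rfl⟩ ⟨c, rfl⟩
        exact ⟨c * b, by ext <;> simp [mul_assoc]⟩ }

/-- The total space of the line bundle `L = G ×_Λ ℂ`. -/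
def LineBundle : Type _ := Quotient (bundleSetoid Λ)

/-- The class `[g, z]` in `L`. -/
def cls (g : G) (z : ℂ) : LineBundle Λ := Quotient.mk (bundleSetoid Λ) (g, z)

variable {Λ} in
theorem cls_eq_iff {g g' : G} {z z' : ℂ} : cls Λ g z = cls Λ g' z' ↔
    ∃ b : isotropy I G η, g' = g * (b : G)⁻¹ ∧ z' = (Λ b : ℂ) * z := by
  have h : cls Λ g z = cls Λ g' z' ↔ (bundleSetoid Λ).r (g, z) (g', z') := Quotient.eq
  rw [h]
  exact exists_congr fun b => Prod.mk.injEq .. ▸ Iff.rfl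

/-- The projection `π : L → 𝓞_η`, `[g, z] ↦ g · η`. -/
def proj : LineBundle Λ → orbit I G η :=
  Quotient.lift (fun x : G × ℂ => orbitMap I η x.1) (by
    rintro x y ⟨b, rfl⟩
    exact orbitMap_eq_iff.2 (by simp))

@[simp] theorem proj_cls (g : G) (z : ℂ) : proj Λ (cls Λ g z) = orbitMap I η g := rfl

/-- The fibre `L_p`. -/
def Fiber (p : orbit I G η) : Type _ := {y : LineBundle Λ // proj Λ y = p}

/-- For `g · η = p`, the bijection `ℂ → L_p`, `z ↦ [g, z]`. -/
def fiberEquiv (p : orbit I G η) (g : G) (hg : orbitMap I η g = p) : ℂ ≃ Fiber Λ p :=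
  Equiv.ofBijective (fun z => ⟨cls Λ g z, hg⟩) (by
    constructor
    · intro z z' h
      obtain ⟨b, hb, hz⟩ := cls_eq_iff.1 (congrArg Subtype.val h)
      have hb1 : b = 1 := by
        have : (b : G)⁻¹ = 1 := by simpa using hb
        exact Subtype.ext (by simpa using this)
      simpa [hb1] using hz.symm
    · rintro ⟨y, hy⟩
      induction y using Quotient.ind with
      | _ x =>
        obtain ⟨g', z'⟩ := x
        have hm : g⁻¹ * g' ∈ isotropy I G η := orbitMap_eq_iff.1 (hg.trans hy.symm)
        refine ⟨(Λ ⟨g⁻¹ * g', hm⟩ : ℂ) * z', Subtype.ext ?_⟩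
        exact (cls_eq_iff (g := g') (z := z')).2 ⟨⟨g⁻¹ * g', hm⟩, by simp, rfl⟩ |>.symm)

/-- The complex vector space structure of `L_p`, transported along `z ↦ [g, z]` for some `g` with
`g · η = p`; by `cls_add` and `cls_smul` it does not depend on the choice of `g`. -/
instance fiberAddCommGroup (p : orbit I G η) : AddCommGroup (Fiber Λ p) :=
  (fiberEquiv Λ p (Classical.choose p.2)
    (Subtype.ext (Classical.choose_spec p.2))).symm.addCommGroup

instance fiberModule (p : orbit I G η) : Module ℂ (Fiber Λ p) :=
  (fiberEquiv Λ p (Classical.choose p.2)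
    (Subtype.ext (Classical.choose_spec p.2))).symm.module ℂ

/-- The element `[g, z]` of the fibre over `g · η`. -/
def pt (g : G) (z : ℂ) : Fiber Λ (orbitMap I η g) := ⟨cls Λ g z, rfl⟩

theorem exists_linear (p : orbit I G η) (g : G) (hg : orbitMap I η g = p) :
    ∃ e : ℂ ≃ₗ[ℂ] Fiber Λ p, ∀ z, e z = fiberEquiv Λ p g hg z := by
  set g₀ := Classical.choose p.2 with hg₀
  have h₀ : orbitMap I η g₀ = p := Subtype.ext (Classical.choose_spec p.2)
  let e₀ : Fiber Λ p ≃ₗ[ℂ] ℂ := (fiberEquiv Λ p g₀ h₀).symm.linearEquiv ℂ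
  have he₀ : ∀ z, e₀.symm z = fiberEquiv Λ p g₀ h₀ z := fun z => rfl
  have hm : g₀⁻¹ * g ∈ isotropy I G η := orbitMap_eq_iff.1 (h₀.trans hg.symm)
  let u : ℂˣ := Units.mk0 (Λ ⟨g₀⁻¹ * g, hm⟩ : ℂ) (Circle.coe_ne_zero _)
  refine ⟨(LinearEquiv.smulOfUnit u).trans e₀.symm, fun z => ?_⟩
  rw [LinearEquiv.trans_apply, he₀]
  refine Subtype.ext ?_
  exact (cls_eq_iff (g := g) (z := z)).2 ⟨⟨g₀⁻¹ * g, hm⟩, by simp, rfl⟩ |>.symm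

theorem cls_add (g : G) (z w : ℂ) : pt Λ g (z + w) = pt Λ g z + pt Λ g w := by
  obtain ⟨e, he⟩ := exists_linear Λ (orbitMap I η g) g rfl
  have h : ∀ z, pt Λ g z = e z := fun z => (he z).symm
  rw [h, h, h, map_add]

theorem cls_smul (g : G) (c z : ℂ) : pt Λ g (c * z) = c • pt Λ g z := by
  obtain ⟨e, he⟩ := exists_linear Λ (orbitMap I η g) g rfl
  have h : ∀ z, pt Λ g z = e z := fun z => (he z).symm
  rw [h, h, ← smul_eq_mul, map_smul]

/-- The sections of `L` (not necessarily smooth), a complex vector space. -/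
abbrev Sec : Type _ := (p : orbit I G η) → Fiber Λ p

/-- An element `y` of `L` as an element of the fibre over `π(y)`. -/
def inFiber (y : LineBundle Λ) : Fiber Λ (proj Λ y) := ⟨y, rfl⟩

/-- `L^× = L - {zero section}`. -/
def LCross : Type _ := {y : LineBundle Λ // inFiber Λ y ≠ 0}

theorem pt_ne_zero (g : G) {z : ℂ} (hz : z ≠ 0) : pt Λ g z ≠ 0 := by
  obtain ⟨e, he⟩ := exists_linear Λ (orbitMap I η g) g rfl
  have h : pt Λ g z = e z := (he z).symm
  rw [h]
  exact (LinearEquiv.map_ne_zero_iff e).2 hz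

/-- The quotient map `q : G × ℂˣ → L^×`, `(g, z) ↦ [g, z]`. -/
def quot (x : G × ℂˣ) : LCross Λ := ⟨cls Λ x.1 x.2, pt_ne_zero Λ x.1 x.2.ne_zero⟩

theorem exists_sharp (σ : Sec Λ) (y : LCross Λ) :
    ∃ c : ℂ, σ (proj Λ y.1) = c • inFiber Λ y.1 := by
  obtain ⟨y, hy⟩ := y
  obtain ⟨⟨g, z⟩, rfl⟩ := Quotient.exists_rep y
  obtain ⟨e, he⟩ := exists_linear Λ (orbitMap I η g) g rfl
  have hp : ∀ z, pt Λ g z = e z := fun z => (he z).symm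
  change pt Λ g z ≠ 0 at hy
  change ∃ c : ℂ, σ (orbitMap I η g) = c • pt Λ g z
  have hz : z ≠ 0 := by
    rintro rfl
    exact hy (by rw [hp, map_zero])
  refine ⟨e.symm (σ (orbitMap I η g)) / z, ?_⟩
  rw [← cls_smul, div_mul_cancel₀ _ hz, hp, LinearEquiv.apply_symm_apply]

/-- The function `σ^♯ : L^× → ℂ` of a section `σ`, determined by `σ(π(y)) = σ^♯(y) y`. -/
def sharp (σ : Sec Λ) (y : LCross Λ) : ℂ := Classical.choose (exists_sharp Λ σ y)

theorem sharp_spec (σ : Sec Λ) (y : LCross Λ) :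
    σ (proj Λ y.1) = sharp Λ σ y • inFiber Λ y.1 :=
  Classical.choose_spec (exists_sharp Λ σ y)

theorem sharp_unique (σ : Sec Λ) (y : LCross Λ) (c : ℂ)
    (h : σ (proj Λ y.1) = c • inFiber Λ y.1) : sharp Λ σ y = c := by
  obtain ⟨⟨g, z⟩, hyz⟩ := Quotient.exists_rep y.1
  by_contra hne
  have h2 := (sharp_spec Λ σ y).symm.trans h
  obtain ⟨e, -⟩ := exists_linear Λ (proj Λ y.1) g (by rw [← hyz]; rfl)
  have h3 := congrArg e.symm h2
  rw [map_smul, map_smul, smul_eq_mul, smul_eq_mul] at h3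
  exact hne (mul_right_cancel₀ ((LinearEquiv.map_ne_zero_iff e.symm).2 y.2) h3)

theorem sharp_add (σ τ : Sec Λ) (y : LCross Λ) :
    sharp Λ (σ + τ) y = sharp Λ σ y + sharp Λ τ y :=
  sharp_unique Λ _ _ _ (by
    rw [Pi.add_apply, add_smul, ← sharp_spec, ← sharp_spec])

theorem sharp_smul (c : ℂ) (σ : Sec Λ) (y : LCross Λ) :
    sharp Λ (c • σ) y = c * sharp Λ σ y :=
  sharp_unique Λ _ _ _ (by
    rw [Pi.smul_apply, mul_smul, ← sharp_spec])

theorem sharp_zero (y : LCross Λ) : sharp Λ (0 : Sec Λ) y = 0 :=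
  sharp_unique Λ _ _ _ (by rw [zero_smul]; rfl)

/-- `C^∞(L)`: the sections `σ` for which `σ^♯` is a smooth function on the principal bundle `L^×`.
As `q : G × ℂˣ → L^×` is a surjective submersion, a function `F` on `L^×` is smooth if and only
if `F ∘ q` is. -/
def SmoothSec : Submodule ℂ (Sec Λ) where
  carrier := {σ | ContMDiff (I.prod 𝓘(ℝ, ℂ)) 𝓘(ℝ, ℂ) ∞ fun x : G × ℂˣ => sharp Λ σ (quot Λ x)}
  zero_mem' := by
    have h : (fun x : G × ℂˣ => sharp Λ (0 : Sec Λ) (quot Λ x)) = fun _ => 0 :=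
      funext fun x => sharp_zero Λ _
    show ContMDiff _ _ _ _
    rw [h]
    exact contMDiff_const
  add_mem' := by
    intro σ τ hσ hτ
    have h : (fun x : G × ℂˣ => sharp Λ (σ + τ) (quot Λ x))
        = fun x => sharp Λ σ (quot Λ x) + sharp Λ τ (quot Λ x) :=
      funext fun x => sharp_add Λ σ τ _
    show ContMDiff _ _ _ _
    rw [h]
    exact ContMDiff.add hσ hτ
  smul_mem' := by
    intro c σ hσ
    have h : (fun x : G × ℂˣ => sharp Λ (c • σ) (quot Λ x))
        = fun x => c * sharp Λ σ (quot Λ x) :=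
      funext fun x => sharp_smul Λ c σ _
    show ContMDiff _ _ _ _
    rw [h]
    exact (contDiff_const.mul contDiff_id).contMDiff.comp hσ

/-- `𝓔_Λ`: the smooth functions `s : G → ℂ` with `s(g b⁻¹) = Λ(b) s(g)` for `b ∈ G_η`. -/
def EquivariantFunctions : Submodule ℂ (G → ℂ) where
  carrier := {s | ContMDiff I 𝓘(ℝ, ℂ) ∞ s ∧
    ∀ (g : G) (b : isotropy I G η), s (g * (b : G)⁻¹) = (Λ b : ℂ) * s g}
  zero_mem' := ⟨contMDiff_const, by simp⟩
  add_mem' := by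
    rintro s t ⟨hs, hs'⟩ ⟨ht, ht'⟩
    exact ⟨hs.add ht, fun g b => by simp [hs', ht', mul_add]⟩
  smul_mem' := by
    rintro c s ⟨hs, hs'⟩
    exact ⟨(contDiff_const.mul contDiff_id (𝕜 := ℝ) (f := fun _ => c)).contMDiff.comp hs, fun g b => by simp [hs', mul_left_comm]⟩

variable (η) in
/-- The pull-back to `G × ℂˣ` of the connection form `Ω = (θ, d)` of `L^×`, at `(g, z)`:
`θ` is the left invariant form on `G` with value `η` at `1`, and the second component is
`(2πi)⁻¹ dz / z`. -/
def connectionForm (g : G) (z : ℂˣ) (V : TangentSpace I g) (w : TangentSpace 𝓘(ℝ, ℂ) z) : ℂ :=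
  ((η (mfderiv I I (fun a : G => g⁻¹ * a) g V : E) : ℝ) : ℂ)
    + (2 * Real.pi * Complex.I)⁻¹ *
      ((z : ℂ)⁻¹ * (show ℂ from mfderiv 𝓘(ℝ, ℂ) 𝓘(ℝ, ℂ) (Units.val : ℂˣ → ℂ) z w))

/-- The tangent vector `dq(V, w)` of `L^×` at `[g, z]` is the horizontal lift of the value of the
vector field `X` at `g · η`: it projects to `X(g · η)` and is annihilated by `Ω`. -/
def IsHorizontalLift (X : (p : orbit I G η) → orbitTangent I G η p)
    (g : G) (z : ℂˣ) (V : TangentSpace I g) (w : TangentSpace 𝓘(ℝ, ℂ) z) : Prop :=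
  orbitMapDeriv I η g V = (X (orbitMap I η g) : LieDual E) ∧ connectionForm (I := I) η g z V w = 0

/-- The section `τ` is the covariant derivative of `σ` along `X`, that is
`τ^♯ = X^♯(σ^♯)` on `L^×` with `X^♯` the horizontal lift of `X`. The derivative of `σ^♯` in the
direction `dq(V, w)` is the derivative of `σ^♯ ∘ q` in the direction `(V, w)`. -/
def IsCovariantDerivative (X : (p : orbit I G η) → orbitTangent I G η p) (σ τ : Sec Λ) : Prop :=
  ∀ (g : G) (z : ℂˣ) (V : TangentSpace I g) (w : TangentSpace 𝓘(ℝ, ℂ) z),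
    IsHorizontalLift X g z V w →
      sharp Λ τ (quot Λ (g, z)) =
        mfderiv (I.prod 𝓘(ℝ, ℂ)) 𝓘(ℝ, ℂ) (fun x : G × ℂˣ => sharp Λ σ (quot Λ x)) (g, z) (V, w)

open Classical in
/-- The covariant derivative `D_X σ` of a smooth section `σ`. -/
def covariantDerivative (X : (p : orbit I G η) → orbitTangent I G η p) (σ : Sec Λ) : Sec Λ :=
  if h : ∃! τ : Sec Λ, IsCovariantDerivative Λ X σ τ then h.choose else 0

/-- The prequantization operator `P_A = -D_{X_A} - 2πi f_A`. -/
def prequantization (A : GroupLieAlgebra I G) (σ : Sec Λ) : Sec Λ := fun p =>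
  -(covariantDerivative Λ (fundamentalField I η A) σ p)
    - (2 * Real.pi * Complex.I * ((hamiltonian I η A p : ℝ) : ℂ)) • σ p

end LineBundle

section RightInvariant

variable {E : Type*} [NormedAddCommGroup E] [NormedSpace ℝ E]
  {H : Type*} [TopologicalSpace H] {I : ModelWithCorners ℝ E H}
  {G : Type*} [TopologicalSpace G] [ChartedSpace H G] [Group G]

/-- The right invariant vector field `R_A` on `G` with value `A` at `1`. -/
def rightInvariantField (A : GroupLieAlgebra I G) (g : G) : TangentSpace I g :=
  (mfderiv I I (fun a : G => a * g) (1 : G) A : E)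

/-- The derivative `R_A(s)` of a function `s` along `R_A`. -/
def rightInvariantDeriv (A : GroupLieAlgebra I G) (s : G → ℂ) (g : G) : ℂ :=
  mfderiv I 𝓘(ℝ, ℂ) s g (rightInvariantField A g)

end RightInvariant

end CoadjointOrbit

end

open scoped Manifold ContDiff Topology

noncomputable section

/-! A section with `σ(g · η) = [g, s(g)]` has `σ^♯([g, z]) = s(g) / z`, so the connection can be
computed on `G × ℂˣ`. A vector `(V, w)` is annihilated by `Ω` exactly when `dz / z = -2πi θ(V)`, and
the derivative of `s / z` along it is then `(ds(V) + 2πi θ(V) s) / z`.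

For `D_{X_A} σ` to exist, this must be the same for all `V` over `X_A(g · η)`. Two choices differ by
the left translate `gC` of some `C` with `C · η = 0`. Such a `C` is the velocity at `1` of a smooth
curve `c` in `G_η` (`exists_isotropy_curve`), and differentiating `Λ(c) s(gc) = s(g)` gives `ds(gC)
= -2πi η(C) s(g)`, which cancels the change of `θ` (`modelDeriv_mul_left_of_isotropy`,
`modelDeriv_add_of_orbitMapDeriv_eq`).

One may therefore take `V = R_A(g)`, for which `θ(V) = η(Ad g⁻¹ A) = (g · η)(A) = -f_A(g · η)`. Thus
`D_{X_A}` becomes `R_A - 2πi f_A` on `𝓔_Λ`, and the potential term of `P_A` leaves exactly `-R_A`.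
-/

namespace CoadjointOrbit

/-! ### Calculus: derivatives of families, regularity of solutions, chain rules. -/

section Calculus

variable {E : Type*} [NormedAddCommGroup E] [NormedSpace ℝ E]
  {H : Type*} [TopologicalSpace H] {I : ModelWithCorners ℝ E H}
  {M : Type*} [TopologicalSpace M] [ChartedSpace H M]
  {E₁ : Type*} [NormedAddCommGroup E₁] [NormedSpace ℝ E₁]
  {H₁ : Type*} [TopologicalSpace H₁] {J : ModelWithCorners ℝ E₁ H₁}
  {N : Type*} [TopologicalSpace N] [ChartedSpace H₁ N]
  {F : Type*} [NormedAddCommGroup F] [NormedSpace ℝ F]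

/-- The derivative at a fixed point of a smooth family of maps into a vector space depends
smoothly on the parameter. -/
theorem contMDiffAt_mfderiv_family [IsManifold I ∞ M] [IsManifold J ∞ N] {f : N → M → F}
    {x₀ : N} {m₀ : M} (hf : ContMDiffAt (J.prod I) 𝓘(ℝ, F) ∞ (Function.uncurry f) (x₀, m₀)) :
    ContMDiffAt (M' := E →L[ℝ] F) J 𝓘(ℝ, E →L[ℝ] F) ∞
      (fun x => mfderiv I 𝓘(ℝ, F) (f x) m₀) x₀ := by
  have := IsManifold.of_le (I := I) (M := M) (m := 1) (n := ∞) (by simp)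
  have := IsManifold.of_le (I := J) (M := N) (m := 1) (n := ∞) (by simp)
  have h := ContMDiffAt.mfderiv (I := I) (I' := 𝓘(ℝ, F)) (m := ∞) f (fun _ => m₀) hf contMDiffAt_const
    (by simp)
  refine h.congr_of_eventuallyEq (Filter.Eventually.of_forall fun x => ?_)
  -- The base point `m₀` is fixed and the target is a vector space, so both coordinate changes are
  -- the identity and the derivative in tangent coordinates is the derivative itself.
  refine Eq.symm ((inTangentCoordinates_eq (I := I) (I' := 𝓘(ℝ, F)) (fun _ : N => m₀)
    (fun x => f x m₀) _ (mem_chart_source H m₀) (Set.mem_univ _)).trans ?_)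
  ext v
  have h1 : (tangentBundleCore I M).coordChange (achart H m₀) (achart H m₀) m₀ v = v :=
    (tangentBundleCore I M).coordChange_self _ _ (mem_chart_source H m₀) v
  have h2 (a b : F) (w : F) : (tangentBundleCore 𝓘(ℝ, F) F).coordChange (achart F a) (achart F b) a w
      = w := by
    simp
  exact (h2 _ _ _).trans (congrArg (mfderiv I 𝓘(ℝ, F) (f x) m₀) h1)

/-- A solution of an autonomous differential equation with smooth right hand side is smooth. -/
theorem contDiffAt_of_hasDerivAt_comp {f : ℝ → E} {X : E → E} {t₀ : ℝ}
    (hX : ContDiffAt ℝ ∞ X (f t₀)) (hf : ∀ᶠ t in 𝓝 t₀, HasDerivAt f (X (f t)) t) :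
    ContDiffAt ℝ ∞ f t₀ := by
  rw [contDiffAt_infty]
  intro n
  -- Bootstrapping: if `f` is `C^n`, then so is `f' = X ∘ f`, hence `f` is `C^(n+1)`.
  induction n with
  | zero =>
    exact contDiffAt_zero.2 ⟨_, hf, fun t ht => ht.continuousAt.continuousWithinAt⟩
  | succ n ih =>
    refine contDiffAt_succ_iff_hasFDerivAt.2
      ⟨fun t => ContinuousLinearMap.toSpanSingleton ℝ (X (f t)), ⟨_, hf, fun t ht => ht⟩, ?_⟩
    exact (ContinuousLinearMap.toSpanSingletonCLE (𝕜 := ℝ) (E := E)).contDiff.contDiffAt.comp t₀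
      ((hX.of_le (mod_cast le_top)).comp t₀ ih)

/-- Chain rule allowing the intermediate point to be a simplified form `y` of `f x`, such as `g` for
`g * 1`. Reading all tangent spaces as model spaces avoids any transport. -/
theorem mfderiv_comp_eq {f : M → N} {g : N → F} {x : M} {y : N} (hy : f x = y)
    (hg : MDifferentiableAt J 𝓘(ℝ, F) g y) (hf : MDifferentiableAt I J f x) (v : E) :
    (mfderiv I 𝓘(ℝ, F) (fun a => g (f a)) x : E →L[ℝ] F) v
      = (mfderiv J 𝓘(ℝ, F) g y : E₁ →L[ℝ] F) ((mfderiv I J f x : E →L[ℝ] E₁) v) := by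
  subst hy
  exact congrArg (fun T : E →L[ℝ] F => T v) (mfderiv_comp x hg hf)

theorem hasDerivAt_comp_of_mdifferentiableAt {f : M → F} {c : ℝ → M} {t : ℝ}
    (hf : MDifferentiableAt I 𝓘(ℝ, F) f (c t)) (hc : MDifferentiableAt 𝓘(ℝ, ℝ) I c t) :
    HasDerivAt (fun t => f (c t)) ((mfderiv I 𝓘(ℝ, F) f (c t) : E →L[ℝ] F)
      ((mfderiv 𝓘(ℝ, ℝ) I c t : ℝ →L[ℝ] E) 1)) t := by
  let T : E →L[ℝ] F := mfderiv I 𝓘(ℝ, F) f (c t)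
  let S : ℝ →L[ℝ] E := mfderiv 𝓘(ℝ, ℝ) I c t
  have h : HasFDerivAt (fun t => f (c t)) (T.comp S) t :=
    (hf.hasMFDerivAt.comp t hc.hasMFDerivAt).hasFDerivAt
  exact h.hasDerivAt

theorem mfderiv_eq_of_hasMFDerivAt_smulRight {c : ℝ → M} {t : ℝ} {V : TangentSpace I (c t)}
    (hc : HasMFDerivAt 𝓘(ℝ, ℝ) I c t ((1 : ℝ →L[ℝ] ℝ).smulRight V)) :
    (mfderiv 𝓘(ℝ, ℝ) I c t : ℝ →L[ℝ] E) 1 = V :=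
  (congrArg (fun T : ℝ →L[ℝ] E => T 1) hc.mfderiv).trans (one_smul ℝ (V : E))

/-- Read in its own chart, the chart is the identity. Composing with it therefore turns a map into a
vector-valued one without altering its derivative. -/
theorem mfderiv_extChartAt_self (x : M) [IsManifold I 1 M] :
    (mfderiv I 𝓘(ℝ, E) (extChartAt I x) x : E →L[ℝ] E) = ContinuousLinearMap.id ℝ E := by
  have h : MDifferentiableAt I 𝓘(ℝ, E) (extChartAt I x) x :=
    (contMDiffAt_extChartAt (n := 1)).mdifferentiableAt (by simp)
  rw [h.mfderiv]
  have : Set.EqOn (writtenInExtChartAt I 𝓘(ℝ, E) x (extChartAt I x)) id (extChartAt I x).target := by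
    intro y hy
    simp only [writtenInExtChartAt, extChartAt_model_space_eq_id, PartialEquiv.refl_coe,
      Function.comp_apply, id]
    exact (extChartAt I x).right_inv hy
  rw [Filter.EventuallyEq.fderivWithin_eq (this.eventuallyEq_of_mem
    (extChartAt_target_mem_nhdsWithin x)) (this (mem_extChartAt_target x))]
  exact fderivWithin_id (I.uniqueDiffOn _ (by simp))

end Calculus

/-! ### Smoothness of the coadjoint action and curves in the isotropy group. -/

section Group

variable {E : Type*} [NormedAddCommGroup E] [NormedSpace ℝ E]
  {H : Type*} [TopologicalSpace H] {I : ModelWithCorners ℝ E H}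
  {G : Type*} [TopologicalSpace G] [ChartedSpace H G] [Group G] [LieGroup I ∞ G]
  {F : Type*} [NormedAddCommGroup F] [NormedSpace ℝ F]

theorem mdifferentiableAt_mul_left (g x : G) : MDifferentiableAt I I (fun a : G => g * a) x :=
  (contMDiff_mul_left (I := I) (n := ∞) (a := g)).contMDiffAt.mdifferentiableAt (by simp)

theorem mdifferentiableAt_mul_right (g x : G) : MDifferentiableAt I I (fun a : G => a * g) x :=
  (contMDiff_mul_right (I := I) (n := ∞) (a := g)).contMDiffAt.mdifferentiableAt (by simp)

variable (I) in
-- Conjugation fixes `1`, so following it by the chart at `1` gives a smooth family of vector-valued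
-- maps whose derivative at `1` is still `Ad g`.
theorem contMDiff_Ad : ContMDiff I 𝓘(ℝ, E →L[ℝ] E) ∞ (Ad I : G → E →L[ℝ] E) := by
  intro g₀
  have : IsManifold I ∞ G := inferInstance
  have : IsManifold I 1 G := IsManifold.of_le (n := ∞) (by simp)
  have hconj : ContMDiff (I.prod I) I ∞ (fun x : G × G => x.1 * x.2 * x.1⁻¹) :=
    (contMDiff_fst.mul contMDiff_snd).mul (contMDiff_fst.inv)
  have h1 : g₀ * 1 * g₀⁻¹ = (1 : G) := by simp
  have hf : ContMDiffAt (I.prod I) 𝓘(ℝ, E) ∞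
      (Function.uncurry fun g a : G => extChartAt I (1 : G) (g * a * g⁻¹)) (g₀, 1) := by
    refine ContMDiffAt.comp (g₀, (1 : G)) (f := fun x : G × G => x.1 * x.2 * x.1⁻¹)
      (g := extChartAt I (1 : G)) ?_ hconj.contMDiffAt
    dsimp only
    rw [h1]
    exact contMDiffAt_extChartAt
  refine (contMDiffAt_mfderiv_family hf).congr_of_eventuallyEq (Filter.Eventually.of_forall ?_)
  intro g
  ext v
  refine Eq.symm ((mfderiv_comp_eq (y := (1 : G)) (by simp)
    ((contMDiffAt_extChartAt (n := ∞)).mdifferentiableAt (by simp))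
    (mdifferentiableAt_conj I g 1) v).trans ?_)
  exact congrArg (fun T : E →L[ℝ] E => T (Ad I g v)) (mfderiv_extChartAt_self (I := I) (1 : G))

theorem contMDiff_coAd (ν : LieDual E) :
    ContMDiff I 𝓘(ℝ, LieDual E) ∞ (fun g : G => coAd I g ν) :=
  (ContinuousLinearMap.compL ℝ E E ℝ ν).contDiff.contMDiff.comp
    ((contMDiff_Ad I).comp (contMDiff_inv I ∞))

theorem mdifferentiableAt_coAd (ν : LieDual E) (g : G) :
    MDifferentiableAt I 𝓘(ℝ, LieDual E) (fun g : G => coAd I g ν) g :=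
  (contMDiff_coAd ν).contMDiffAt.mdifferentiableAt (by simp)

/-- The derivative of the orbit map at `g`, on left translates. -/
theorem orbitMapDeriv_mul_left (η : LieDual E) (g : G) (C : E) :
    orbitMapDeriv I η g (mfderiv I I (fun a : G => g * a) 1 C : E)
      = coAd I g (mfderiv I 𝓘(ℝ, LieDual E) (fun a : G => coAd I a η) (1 : G) C) := by
  have h1 := mfderiv_comp_eq (y := g) (mul_one g) (mdifferentiableAt_coAd (I := I) η g)
    (mdifferentiableAt_mul_left g (1 : G)) C
  have h2 : (fun a : G => coAd I (g * a) η) = fun a => coAd I g (coAd I a η) :=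
    funext fun a => coAd_mul I g a η
  rw [h2] at h1
  refine h1.symm.trans ?_
  -- Differentiation passes through `coAd I g` because it is a continuous linear map of `𝔤*`.
  let T : LieDual E →L[ℝ] LieDual E := (ContinuousLinearMap.compL ℝ E E ℝ).flip (Ad I g⁻¹)
  refine (mfderiv_comp_eq (I := I) (J := 𝓘(ℝ, LieDual E)) (f := fun a : G => coAd I a η) (g := T)
    (x := (1 : G)) rfl T.mdifferentiableAt (mdifferentiableAt_coAd η 1) C).trans ?_
  rw [T.mfderiv_eq]
  rfl

/-- The derivative of the orbit map at `g`, on right translates. -/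
theorem orbitMapDeriv_mul_right (η : LieDual E) (g : G) (A : GroupLieAlgebra I G) :
    orbitMapDeriv I η g (rightInvariantField A g) = fundamentalVector I A (coAd I g η) := by
  let A' : E := A
  have h1 := mfderiv_comp_eq (f := fun a : G => a * g) (y := g) (one_mul g)
    (mdifferentiableAt_coAd (I := I) η g) (mdifferentiableAt_mul_right g (1 : G)) A'
  have h2 : (fun a : G => coAd I (a * g) η) = fun a => coAd I a (coAd I g η) :=
    funext fun a => coAd_mul I a g η
  rw [h2] at h1
  exact h1.symm

theorem mfderiv_inv_mul_left (g : G) (V : E) :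
    (mfderiv I I (fun a : G => g * a) 1 : E →L[ℝ] E)
      ((mfderiv I I (fun a : G => g⁻¹ * a) g : E →L[ℝ] E) V) = V := by
  have h := mfderiv_comp (I := I) (I' := I) (I'' := I) g
    (mdifferentiableAt_mul_left g (g⁻¹ * g)) (mdifferentiableAt_mul_left g⁻¹ g)
  have e : (fun a : G => g * a) ∘ (fun a : G => g⁻¹ * a) = id := by ext; simp
  rw [e, mfderiv_id] at h
  have : ∀ x : G, x = 1 →
      (mfderiv I I (fun a : G => g * a) x : E →L[ℝ] E)
        = mfderiv I I (fun a : G => g * a) (1 : G) := by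
    rintro x rfl; rfl
  rw [← this _ (inv_mul_cancel g)]
  exact (congrArg (fun T : E →L[ℝ] E => T V) h).symm

/-- The left translate by `g⁻¹` of the right invariant field is `Ad g⁻¹ A`. -/
theorem mfderiv_inv_mul_rightInvariantField (g : G) (A : GroupLieAlgebra I G) :
    (mfderiv I I (fun a : G => g⁻¹ * a) g : E →L[ℝ] E) (rightInvariantField A g) = Ad I g⁻¹ A := by
  have h := mfderiv_comp (I := I) (I' := I) (I'' := I) (1 : G)
    (mdifferentiableAt_mul_left g⁻¹ (1 * g)) (mdifferentiableAt_mul_right g (1 : G))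
  have e : (fun a : G => g⁻¹ * a) ∘ (fun a : G => a * g) = fun a => g⁻¹ * a * g⁻¹⁻¹ := by
    ext; simp [mul_assoc]
  rw [e] at h
  have : ∀ x : G, x = g →
      (mfderiv I I (fun a : G => g⁻¹ * a) x : E →L[ℝ] E)
        = mfderiv I I (fun a : G => g⁻¹ * a) g := by
    rintro x rfl; rfl
  rw [← this _ (one_mul g)]
  exact (congrArg (fun T : E →L[ℝ] E => T A) h).symm

/-- The derivative of a smooth function along a right invariant field is smooth. -/
theorem contMDiff_rightInvariantDeriv (A : GroupLieAlgebra I G) {s : G → ℂ}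
    (hs : ContMDiff I 𝓘(ℝ, ℂ) ∞ s) : ContMDiff I 𝓘(ℝ, ℂ) ∞ (rightInvariantDeriv A s) := by
  let A' : E := A
  have : IsManifold I ∞ G := inferInstance
  have hf : ContMDiff (I.prod I) 𝓘(ℝ, ℂ) ∞ (Function.uncurry fun g a : G => s (a * g)) :=
    hs.comp (contMDiff_snd.mul contMDiff_fst)
  intro g₀
  have h := contMDiffAt_mfderiv_family (I := I) (hf.contMDiffAt (x := (g₀, (1 : G))))
  have h2 := (ContinuousLinearMap.apply ℝ ℂ A').contDiff.contMDiff.contMDiffAt.comp g₀ h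
  refine h2.congr_of_eventuallyEq (Filter.Eventually.of_forall fun g => ?_)
  exact (mfderiv_comp_eq (f := fun a : G => a * g) (y := g) (one_mul g) (hs.contMDiffAt.mdifferentiableAt (by simp))
    (mdifferentiableAt_mul_right g (1 : G)) A').symm

/-- Integral curves through `1` of left invariant fields. -/
theorem exists_leftInvariant_curve [CompleteSpace E] [I.Boundaryless] (C : GroupLieAlgebra I G) :
    ∃ c : ℝ → G, c 0 = 1 ∧ ContMDiffAt 𝓘(ℝ, ℝ) I ∞ c 0 ∧
      IsMIntegralCurveAt c (mulInvariantVectorField C) 0 := by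
  let C' : E := C
  have : LieGroup I (minSmoothness ℝ 3) G :=
    LieGroup.of_le (n := ∞) (by simpa using ENat.LEInfty.out)
  have : IsManifold I ∞ G := inferInstance
  have : IsManifold I 1 G := IsManifold.of_le (n := ∞) (by simp)
  obtain ⟨c, hc0, hc⟩ := exists_isMIntegralCurveAt_of_contMDiffAt_boundaryless (t₀ := (0 : ℝ))
    ((contMDiffAt_mulInvariantVectorField C (g := (1 : G))).of_le (by simp))
  refine ⟨c, hc0, ?_, hc⟩
  set φ := extChartAt I (1 : G) with hφ
  -- The existence theorem alone gives only a differentiable curve. In the chart at `1` it solves an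
  -- autonomous equation with right hand side `X`, the left invariant field in coordinates, which is
  -- smooth; so the curve is smooth.
  let X : E → E := fun x => (mfderiv I 𝓘(ℝ, E) (fun a : G => φ (φ.symm x * a)) 1 : E →L[ℝ] E) C
  have hX : ContDiffAt ℝ ∞ X (φ (c 0)) := by
    rw [hc0, ← contMDiffAt_iff_contDiffAt]
    have hsymm : ContMDiffAt 𝓘(ℝ, E) I ∞ φ.symm (φ 1) :=
      (contMDiffOn_extChartAt_symm (1 : G)).contMDiffAt (extChartAt_target_mem_nhds (1 : G))
    have hf : ContMDiffAt (𝓘(ℝ, E).prod I) 𝓘(ℝ, E) ∞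
        (Function.uncurry fun (x : E) (a : G) => φ (φ.symm x * a)) (φ 1, 1) := by
      refine ContMDiffAt.comp (φ 1, (1 : G)) (f := fun x : E × G => φ.symm x.1 * x.2)
        (g := φ) ?_ ((ContMDiffAt.comp (φ 1, (1 : G)) (f := fun x : E × G => x.1)
          (g := φ.symm) hsymm contMDiffAt_fst).mul contMDiffAt_snd)
      dsimp only
      rw [hφ, extChartAt_to_inv, one_mul]
      exact contMDiffAt_extChartAt
    exact (ContinuousLinearMap.apply ℝ E C').contDiff.contMDiff.contMDiffAt.comp _
      (contMDiffAt_mfderiv_family hf)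
  have hev : ∀ᶠ t in 𝓝 (0 : ℝ), c t ∈ (chartAt H (1 : G)).source :=
    hc.continuousAt.eventually_mem
      (by rw [hc0]; exact (chartAt H (1 : G)).open_source.mem_nhds (mem_chart_source H _))
  have hsm : ContDiffAt ℝ ∞ (fun t => φ (c t)) 0 := by
    refine contDiffAt_of_hasDerivAt_comp (X := X) hX ?_
    filter_upwards [hev, hc] with t ht hct
    have hφt : MDifferentiableAt I 𝓘(ℝ, E) φ (c t) :=
      (contMDiffAt_extChartAt' (n := ∞) ht).mdifferentiableAt (by simp)
    refine (hasDerivAt_comp_of_mdifferentiableAt hφt hct.mdifferentiableAt).congr_deriv ?_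
    have hs : φ.symm (φ (c t)) = c t := φ.left_inv (by rwa [hφ, extChartAt_source])
    have h2 := mfderiv_comp_eq (y := c t) (mul_one (c t)) hφt
      (mdifferentiableAt_mul_left (I := I) (c t) (1 : G)) C'
    let Y : G → E := fun y => (mfderiv I 𝓘(ℝ, E) (fun a : G => φ (y * a)) 1 : E →L[ℝ] E) C'
    exact (congrArg (mfderiv I 𝓘(ℝ, E) φ (c t)) (mfderiv_eq_of_hasMFDerivAt_smulRight hct)).trans
      (h2.symm.trans (congrArg Y hs).symm)
  rw [contMDiffAt_iff_target]
  refine ⟨hc.continuousAt, ?_⟩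
  rw [hc0]
  exact hsm.contMDiffAt

/-- A vector annihilated by the derivative of the orbit map is tangent to a smooth curve in the
isotropy group. -/
theorem exists_isotropy_curve [CompleteSpace E] [I.Boundaryless] (η : LieDual E)
    (C : GroupLieAlgebra I G)
    (hC : (mfderiv I 𝓘(ℝ, LieDual E) (fun a : G => coAd I a η) (1 : G) : E →L[ℝ] LieDual E) C = 0) :
    ∃ c : ℝ → isotropy I G η, c 0 = 1 ∧ ContMDiffAt 𝓘(ℝ, ℝ) I ∞ (fun t => (c t : G)) 0 ∧
      (mfderiv 𝓘(ℝ, ℝ) I (fun t => (c t : G)) 0 (1 : ℝ) : E) = C := by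
  obtain ⟨c, hc0, hcs, hc⟩ := exists_leftInvariant_curve (I := I) C
  -- By equivariance the velocity of `t ↦ c(t) · η` is `c(t)` applied to the derivative of the orbit
  -- map at `1` along `C`, which vanishes. Hence `c(t) · η` stays equal to `η` near `0`.
  have hder : ∀ᶠ t in 𝓝 (0 : ℝ), HasDerivAt (fun t => coAd I (c t) η) 0 t := by
    filter_upwards [hc] with t ht
    refine (hasDerivAt_comp_of_mdifferentiableAt (mdifferentiableAt_coAd (I := I) η (c t))
      ht.mdifferentiableAt).congr_deriv ?_
    refine (congrArg (orbitMapDeriv I η (c t)) (mfderiv_eq_of_hasMFDerivAt_smulRight ht)).trans ?_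
    refine (orbitMapDeriv_mul_left η (c t) C).trans ?_
    exact (congrArg (coAd I (c t)) hC).trans (ContinuousLinearMap.zero_comp _)
  have hmem : ∀ᶠ t in 𝓝 (0 : ℝ), c t ∈ isotropy I G η := by
    obtain ⟨ε, hε, hball⟩ := Metric.eventually_nhds_iff_ball.1 hder
    filter_upwards [Metric.ball_mem_nhds (0 : ℝ) hε] with t ht
    have h := Metric.isOpen_ball.is_const_of_deriv_eq_zero (convex_ball (0 : ℝ) ε).isPreconnected
      (fun t ht => (hball t ht).differentiableAt.differentiableWithinAt)
      (fun t ht => (hball t ht).deriv) ht (Metric.mem_ball_self hε)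
    have h2 : coAd I (c t) η = coAd I (c 0) η := h
    rw [hc0, coAd_one] at h2
    exact h2
  classical
  -- Only the germ at `0` matters, so the value `1` where `c` leaves `G_η` is arbitrary.
  let d : ℝ → isotropy I G η := fun t => if h : c t ∈ isotropy I G η then ⟨c t, h⟩ else 1
  have hd : (fun t => (d t : G)) =ᶠ[𝓝 0] c := by
    filter_upwards [hmem] with t ht
    simp [d, ht]
  refine ⟨d, Subtype.ext (hd.self_of_nhds.trans hc0), hcs.congr_of_eventuallyEq hd, ?_⟩
  have h2 : ∀ x : G, x = 1 → (mulInvariantVectorField C x : E) = C := by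
    rintro x rfl
    have : (fun a : G => 1 * a) = id := by ext; simp
    simp only [mulInvariantVectorField]
    rw [this, mfderiv_id]
    rfl
  refine (congrArg (fun T : ℝ →L[ℝ] E => T 1) hd.mfderiv_eq).trans ?_
  exact (mfderiv_eq_of_hasMFDerivAt_smulRight hc.hasMFDerivAt).trans (h2 _ hc0)

end Group

section ModelDeriv

variable {E : Type*} [NormedAddCommGroup E] [NormedSpace ℝ E]
  {H : Type*} [TopologicalSpace H] (I : ModelWithCorners ℝ E H)
  {M : Type*} [TopologicalSpace M] [ChartedSpace H M]
  {E₁ : Type*} [NormedAddCommGroup E₁] [NormedSpace ℝ E₁]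
  {H₁ : Type*} [TopologicalSpace H₁] (J : ModelWithCorners ℝ E₁ H₁)
  {N : Type*} [TopologicalSpace N] [ChartedSpace H₁ N]

/-- `mfderiv`, regarded as a map between the model spaces. -/
def modelDeriv (f : M → N) (x : M) : E →L[ℝ] E₁ := mfderiv I J f x

end ModelDeriv

/-! ### Sections of `L` as equivariant functions on `G`. -/

section Coordinate

variable {E : Type*} [NormedAddCommGroup E] [NormedSpace ℝ E]
  {H : Type*} [TopologicalSpace H] {I : ModelWithCorners ℝ E H}
  {G : Type*} [TopologicalSpace G] [ChartedSpace H G] [Group G] [LieGroup I ∞ G]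
  {η : LieDual E} {Λ : isotropy I G η →ₜ* Circle}

theorem pt_injective (g : G) : Function.Injective (pt Λ g) :=
  (fiberEquiv Λ (orbitMap I η g) g rfl).injective

theorem cls_injective (g : G) : Function.Injective (cls Λ g) := fun _ _ h =>
  pt_injective g (Subtype.ext h)

/-- The function `s` on `G` of a section `σ`, with `σ(g · η) = [g, s(g)]`. -/
def coordinate (σ : Sec Λ) (g : G) : ℂ := sharp Λ σ (quot Λ (g, 1))

theorem section_orbitMap (σ : Sec Λ) (g : G) : σ (orbitMap I η g) = pt Λ g (coordinate σ g) := by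
  have h : σ (orbitMap I η g) = coordinate σ g • pt Λ g 1 := sharp_spec Λ σ (quot Λ (g, 1))
  rw [h, ← cls_smul, mul_one]

theorem coordinate_eq_of_eq_pt {σ : Sec Λ} {g : G} {z : ℂ} (h : σ (orbitMap I η g) = pt Λ g z) :
    coordinate σ g = z :=
  pt_injective g ((section_orbitMap σ g).symm.trans h)

/-- Since `[g, z] = z [g, 1]`, the function `σ^♯` is homogeneous of degree `-1` on fibres; this
reduces every statement about `σ^♯` to one about `s`. -/
theorem sharp_quot (σ : Sec Λ) (g : G) (z : ℂˣ) :
    sharp Λ σ (quot Λ (g, z)) = coordinate σ g * (z : ℂ)⁻¹ := by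
  refine sharp_unique Λ σ _ _ ?_
  change σ (orbitMap I η g) = (coordinate σ g * (z : ℂ)⁻¹) • pt Λ g z
  rw [← cls_smul, inv_mul_cancel_right₀ z.ne_zero, section_orbitMap σ g]

theorem orbitMap_mul_inv (g : G) (b : isotropy I G η) :
    orbitMap I η (g * (b : G)⁻¹) = orbitMap I η g :=
  (orbitMap_eq_iff.2 (by simp)).symm

/-- Both `[g b⁻¹, s(g b⁻¹)]` and `[g, s(g)]` are the value of `σ` at the same point of the orbit. -/
theorem coordinate_mul_inv (σ : Sec Λ) (g : G) (b : isotropy I G η) :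
    coordinate σ (g * (b : G)⁻¹) = (Λ b : ℂ) * coordinate σ g := by
  apply cls_injective (Λ := Λ) (g * (b : G)⁻¹)
  have h (g : G) : cls Λ g (coordinate σ g) = (σ (orbitMap I η g)).1 :=
    (congrArg Subtype.val (section_orbitMap σ g)).symm
  rw [h, orbitMap_mul_inv, ← h]
  exact cls_eq_iff.2 ⟨b, rfl, rfl⟩

/-- The section `g · η ↦ [g, s(g)]` of an equivariant function `s`. -/
def sectionOf (Λ : isotropy I G η →ₜ* Circle) (s : G → ℂ) : Sec Λ := fun p =>
  ⟨cls Λ (Classical.choose p.2) (s (Classical.choose p.2)),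
    Subtype.ext (Classical.choose_spec p.2)⟩

theorem sectionOf_orbitMap {s : G → ℂ}
    (hs : ∀ (g : G) (b : isotropy I G η), s (g * (b : G)⁻¹) = (Λ b : ℂ) * s g) (g : G) :
    sectionOf Λ s (orbitMap I η g) = pt Λ g (s g) := by
  set g' := Classical.choose (orbitMap I η g).2 with hg'
  have h' : orbitMap I η g' = orbitMap I η g :=
    Subtype.ext (Classical.choose_spec (orbitMap I η g).2)
  refine Subtype.ext ?_
  change cls Λ g' (s g') = cls Λ g (s g)
  have hm : g'⁻¹ * g ∈ isotropy I G η := orbitMap_eq_iff.1 h'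
  refine Eq.symm (cls_eq_iff.2 ⟨⟨g'⁻¹ * g, hm⟩, by simp, ?_⟩)
  rw [← hs]
  simp

theorem coordinate_sectionOf {s : G → ℂ}
    (hs : ∀ (g : G) (b : isotropy I G η), s (g * (b : G)⁻¹) = (Λ b : ℂ) * s g) :
    coordinate (sectionOf Λ s) = s :=
  funext fun g => coordinate_eq_of_eq_pt (sectionOf_orbitMap hs g)

theorem section_ext {σ τ : Sec Λ} (h : ∀ g, coordinate σ g = coordinate τ g) : σ = τ := by
  funext p
  obtain ⟨_, g, rfl⟩ := p
  exact (section_orbitMap σ g).trans ((congrArg (pt Λ g) (h g)).trans (section_orbitMap τ g).symm)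

/-- Restriction to `z = 1` gives one direction; the other holds because `z ↦ z⁻¹` is smooth on `ℂˣ`.
-/
theorem mem_smoothSec_iff {σ : Sec Λ} :
    σ ∈ SmoothSec Λ ↔ ContMDiff I 𝓘(ℝ, ℂ) ∞ (coordinate σ) := by
  constructor
  · intro h
    have h' : ContMDiff (I.prod 𝓘(ℝ, ℂ)) 𝓘(ℝ, ℂ) ∞ fun x : G × ℂˣ => sharp Λ σ (quot Λ x) := h
    exact h'.comp (contMDiff_id.prodMk contMDiff_const)
  · intro h
    change ContMDiff (I.prod 𝓘(ℝ, ℂ)) 𝓘(ℝ, ℂ) ∞ fun x : G × ℂˣ => sharp Λ σ (quot Λ x)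
    have e : (fun x : G × ℂˣ => sharp Λ σ (quot Λ x))
        = fun x => coordinate σ x.1 * ((x.2⁻¹ : ℂˣ) : ℂ) := by
      funext ⟨g, z⟩
      rw [sharp_quot, Units.val_inv_eq_inv_val]
    rw [e]
    have h1 : ContMDiff (I.prod 𝓘(ℝ, ℂ)) 𝓘(ℝ, ℂ) ∞ fun x : G × ℂˣ => coordinate σ x.1 :=
      h.comp contMDiff_fst
    have h2 : ContMDiff (I.prod 𝓘(ℝ, ℂ)) 𝓘(ℝ, ℂ) ∞ fun x : G × ℂˣ => ((x.2⁻¹ : ℂˣ) : ℂ) :=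
      Units.contMDiff_val.comp (contMDiff_snd.inv)
    exact (contDiff_mul (𝕜 := ℝ) (𝔸 := ℂ)).contMDiff.comp (h1.prodMk_space h2)

variable (Λ) in
/-- The isomorphism `C^∞(L) ≃ 𝓔_Λ`. -/
def sectionEquiv : SmoothSec Λ ≃ₗ[ℂ] EquivariantFunctions Λ where
  toFun σ := ⟨coordinate σ.1, mem_smoothSec_iff.1 σ.2, coordinate_mul_inv σ.1⟩
  map_add' σ τ := Subtype.ext (funext fun _ => sharp_add Λ σ.1 τ.1 _)
  map_smul' c σ := Subtype.ext (funext fun _ => sharp_smul Λ c σ.1 _)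
  invFun s := ⟨sectionOf Λ s.1, mem_smoothSec_iff.2 (by
    rw [coordinate_sectionOf s.2.2]; exact s.2.1)⟩
  left_inv σ := Subtype.ext (section_ext fun g =>
    congrFun (coordinate_sectionOf (coordinate_mul_inv σ.1)) g)
  right_inv s := Subtype.ext (coordinate_sectionOf s.2.2)

end Coordinate

/-! ### Right invariant derivatives and infinitesimal equivariance. -/

section Derivative

variable {E : Type*} [NormedAddCommGroup E] [NormedSpace ℝ E]
  {H : Type*} [TopologicalSpace H] {I : ModelWithCorners ℝ E H}
  {G : Type*} [TopologicalSpace G] [ChartedSpace H G] [Group G] [LieGroup I ∞ G]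
  {η : LieDual E} {Λ : isotropy I G η →ₜ* Circle}

theorem rightInvariantDeriv_eq (A : E) {s : G → ℂ} (hs : ContMDiff I 𝓘(ℝ, ℂ) ∞ s) (g : G) :
    rightInvariantDeriv (I := I) A s g
      = modelDeriv I 𝓘(ℝ, ℂ) (fun a : G => s (a * g)) 1 A :=
  (mfderiv_comp_eq (f := fun a : G => a * g) (y := g) (one_mul g)
    (hs.contMDiffAt.mdifferentiableAt (by simp)) (mdifferentiableAt_mul_right g (1 : G)) A).symm

theorem modelDeriv_const_mul {M : Type*} [TopologicalSpace M] [ChartedSpace H M] {s : M → ℂ} {x : M}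
    (hs : MDifferentiableAt I 𝓘(ℝ, ℂ) s x) (c : ℂ) (V : E) :
    modelDeriv I 𝓘(ℝ, ℂ) (fun a => c * s a) x V = c * modelDeriv I 𝓘(ℝ, ℂ) s x V := by
  let T : ℂ →L[ℝ] ℂ := ContinuousLinearMap.mul ℝ ℂ c
  refine (mfderiv_comp_eq (J := 𝓘(ℝ, ℂ)) (f := s) (g := T) (x := x) rfl T.mdifferentiableAt hs
    V).trans ?_
  exact congrArg (fun S : ℂ →L[ℝ] ℂ => S (modelDeriv I 𝓘(ℝ, ℂ) s x V)) T.mfderiv_eq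

/-- `R_A` differentiates along left multiplications, which commute with right multiplication by
`b⁻¹`. -/
theorem rightInvariantDeriv_mul_inv (A : E) {s : G → ℂ} (hs : ContMDiff I 𝓘(ℝ, ℂ) ∞ s)
    (hs' : ∀ (g : G) (b : isotropy I G η), s (g * (b : G)⁻¹) = (Λ b : ℂ) * s g)
    (g : G) (b : isotropy I G η) :
    rightInvariantDeriv (I := I) A s (g * (b : G)⁻¹) = (Λ b : ℂ) * rightInvariantDeriv (I := I) A s g := by
  have e : (fun a : G => s (a * (g * (b : G)⁻¹))) = fun a => (Λ b : ℂ) * s (a * g) := by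
    funext a
    rw [← mul_assoc, hs']
  rw [rightInvariantDeriv_eq A hs, rightInvariantDeriv_eq A hs, e]
  refine modelDeriv_const_mul ?_ _ _
  exact (hs.comp (contMDiff_mul_right (I := I) (n := ∞) (a := g))).contMDiffAt.mdifferentiableAt
    (by simp)

variable (Λ) in
/-- The operator `R_A` on `𝓔_Λ`. -/
def rightInvariantEnd (A : GroupLieAlgebra I G) : Module.End ℂ (EquivariantFunctions Λ) where
  toFun s := ⟨rightInvariantDeriv A s.1, contMDiff_rightInvariantDeriv A s.2.1,
    rightInvariantDeriv_mul_inv (show E from A) s.2.1 s.2.2⟩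
  map_add' s t := Subtype.ext (funext fun g => by
    have h := mfderiv_add (I := I) (s.2.1.contMDiffAt.mdifferentiableAt (x := g) (by simp))
      (t.2.1.contMDiffAt.mdifferentiableAt (x := g) (by simp))
    exact congrArg (fun T : E →L[ℝ] ℂ => T (rightInvariantField A g)) h)
  map_smul' c s := Subtype.ext (funext fun g =>
    modelDeriv_const_mul (s.2.1.contMDiffAt.mdifferentiableAt (x := g) (by simp)) c
      (show E from rightInvariantField A g))

/-- Equivariance, infinitesimally: `ds(g C) = -2πi η(C) s(g)` for `C` in the kernel of the
derivative of the orbit map. -/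
theorem modelDeriv_mul_left_of_isotropy [CompleteSpace E] [I.Boundaryless] (hΛ : HasDifferential Λ)
    {s : G → ℂ} (hs : ContMDiff I 𝓘(ℝ, ℂ) ∞ s)
    (hs' : ∀ (g : G) (b : isotropy I G η), s (g * (b : G)⁻¹) = (Λ b : ℂ) * s g) (g : G) (C : E)
    (hC : modelDeriv I 𝓘(ℝ, LieDual E) (fun a : G => coAd I a η) (1 : G) C = 0) :
    modelDeriv I 𝓘(ℝ, ℂ) s g (modelDeriv I I (fun a : G => g * a) 1 C)
      = -(2 * Real.pi * Complex.I * ((η C : ℝ) : ℂ)) * s g := by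
  obtain ⟨c, hc0, hcs, hc⟩ := exists_isotropy_curve η C hC
  have hc0' : (c 0 : G) = 1 := by rw [hc0]; rfl
  have hd := hΛ c hc0 hcs
  have hsg : ContMDiff I 𝓘(ℝ, ℂ) ∞ (fun a : G => s (g * a)) :=
    hs.comp (contMDiff_mul_left (I := I) (n := ∞) (a := g))
  have h1 := hasDerivAt_comp_of_mdifferentiableAt (I := I) (c := fun t => (c t : G)) (t := 0)
    (hsg.contMDiffAt.mdifferentiableAt (by simp)) (hcs.mdifferentiableAt (by simp))
  let Y : G → E → ℂ := fun y =>
    modelDeriv I 𝓘(ℝ, ℂ) (fun a : G => s (g * a)) y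
  have h2 : HasDerivAt (fun t => s (g * c t)) (Y 1 C) 0 := by
    refine h1.congr_deriv ?_
    exact (congrArg (Y (c 0)) hc).trans (congrArg (fun y => Y y C) hc0')
  have h3 : Y 1 C = modelDeriv I 𝓘(ℝ, ℂ) s g (modelDeriv I I (fun a : G => g * a) 1 C) :=
    mfderiv_comp_eq (f := fun a : G => g * a) (mul_one g)
      (hs.contMDiffAt.mdifferentiableAt (by simp)) (mdifferentiableAt_mul_left g (1 : G)) C
  have h4 := hd.mul h2
  -- Equivariance with `b = c(t)` makes this product constant, so the two terms of the product rule
  -- cancel.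
  have h5 : (fun t => (Λ (c t) : ℂ)) * (fun t => s (g * c t)) = fun _ => s g := by
    funext t
    change (Λ (c t) : ℂ) * s (g * c t) = s g
    rw [← hs']
    simp
  rw [h5] at h4
  have h6 := h4.unique (hasDerivAt_const (0 : ℝ) (s g))
  rw [hc0', mul_one, hc0, map_one, Circle.coe_one, one_mul] at h6
  rw [← h3, neg_mul]
  refine eq_neg_of_add_eq_zero_right (Eq.trans ?_ h6)
  exact congrArg (fun x : E => 2 * Real.pi * Complex.I * ((η x : ℝ) : ℂ) * s g + Y 1 C) hc.symm

theorem coAd_injective (g : G) : Function.Injective (coAd I g) := fun ν μ h => by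
  have := congrArg (coAd I g⁻¹) h
  simpa only [← coAd_mul, inv_mul_cancel, coAd_one] using this

/-- For `V` over `X_A`, the expression `ds(V) + 2πi θ(V) s` depends only on `A`. -/
theorem modelDeriv_add_of_orbitMapDeriv_eq [CompleteSpace E] [I.Boundaryless]
    (hΛ : HasDifferential Λ) {s : G → ℂ} (hs : ContMDiff I 𝓘(ℝ, ℂ) ∞ s)
    (hs' : ∀ (g : G) (b : isotropy I G η), s (g * (b : G)⁻¹) = (Λ b : ℂ) * s g)
    (A : GroupLieAlgebra I G) (g : G) (V : E)
    (hV : orbitMapDeriv I η g V = fundamentalVector I A (coAd I g η)) :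
    modelDeriv I 𝓘(ℝ, ℂ) s g V + 2 * Real.pi * Complex.I *
        ((η (modelDeriv I I (fun a : G => g⁻¹ * a) g V) : ℝ) : ℂ) * s g
      = rightInvariantDeriv A s g
        + 2 * Real.pi * Complex.I * ((coAd I g η (A : E) : ℝ) : ℂ) * s g := by
  let R : E := rightInvariantField A g
  let D : E →L[ℝ] ℂ := modelDeriv I 𝓘(ℝ, ℂ) s g
  let L : E →L[ℝ] E := modelDeriv I I (fun a : G => g⁻¹ * a) g
  let K : E →L[ℝ] LieDual E := modelDeriv I 𝓘(ℝ, LieDual E) (fun a : G => coAd I a η) g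
  have hLR : L R = Ad I g⁻¹ (A : E) := mfderiv_inv_mul_rightInvariantField g A
  have hKR : K R = fundamentalVector I A (coAd I g η) := orbitMapDeriv_mul_right η g A
  -- `V - R` is the left translate by `g` of `L (V - R)`. As `V` and `R` have the same image in the
  -- orbit, that vector lies in the kernel of the derivative of the orbit map at `1`.
  have hVR : modelDeriv I I (fun a : G => g * a) 1 (L (V - R)) = V - R :=
    mfderiv_inv_mul_left g (V - R)
  have hK : K (V - R) = 0 := by
    rw [map_sub, hKR, sub_eq_zero]
    exact hV
  have hker : modelDeriv I 𝓘(ℝ, LieDual E) (fun a : G => coAd I a η) (1 : G) (L (V - R)) = 0 := by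
    apply coAd_injective (I := I) g
    refine ((orbitMapDeriv_mul_left η g (L (V - R))).symm.trans
      ((congrArg K hVR).trans hK)).trans ?_
    exact (ContinuousLinearMap.zero_comp _).symm
  have h := modelDeriv_mul_left_of_isotropy hΛ hs hs' g (L (V - R)) hker
  have h' : D (V - R) = -(2 * Real.pi * Complex.I * ((η (L (V - R)) : ℝ) : ℂ)) * s g :=
    (congrArg D hVR).symm.trans h
  rw [map_sub, map_sub, map_sub, hLR] at h'
  change D V + 2 * Real.pi * Complex.I * ((η (L V) : ℝ) : ℂ) * s g
    = D R + 2 * Real.pi * Complex.I * ((η (Ad I g⁻¹ (A : E)) : ℝ) : ℂ) * s g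
  push_cast at h'
  linear_combination h'

end Derivative

/-! ### Horizontal lifts, covariant derivative and prequantization. -/

section Connection

/-- The inclusion of `ℂˣ` in `ℂ` is its chart, so its derivative is invertible. This lets the
horizontality equation be solved for `w`. -/
theorem modelDeriv_units_val_surjective (z : ℂˣ) :
    Function.Surjective (modelDeriv 𝓘(ℝ, ℂ) 𝓘(ℝ, ℂ) (Units.val : ℂˣ → ℂ) z) := by
  have h := isInvertible_mfderiv_extChartAt (I := 𝓘(ℝ, ℂ)) (mem_extChartAt_source (I := 𝓘(ℝ, ℂ)) z)
  obtain ⟨e, he⟩ := h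
  intro v
  exact ⟨e.symm v, (congrArg (fun T : ℂ →L[ℝ] ℂ => T (e.symm v)) he).symm.trans
    (e.apply_symm_apply v)⟩

theorem modelDeriv_const_mul_units_inv (c : ℂ) (z : ℂˣ) (w : ℂ) :
    modelDeriv 𝓘(ℝ, ℂ) 𝓘(ℝ, ℂ) (fun b : ℂˣ => c * (b : ℂ)⁻¹) z w
      = -c * (z : ℂ)⁻¹ * (z : ℂ)⁻¹ * modelDeriv 𝓘(ℝ, ℂ) 𝓘(ℝ, ℂ) (Units.val : ℂˣ → ℂ) z w := by
  have h : HasDerivAt (fun x : ℂ => c * x⁻¹) (c * -((z : ℂ) ^ 2)⁻¹) z :=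
    (hasDerivAt_inv z.ne_zero).const_mul c
  have h' := (h.hasFDerivAt.restrictScalars ℝ).hasMFDerivAt
  refine (mfderiv_comp_eq (I := 𝓘(ℝ, ℂ)) (J := 𝓘(ℝ, ℂ)) (f := (Units.val : ℂˣ → ℂ))
    (g := fun x : ℂ => c * x⁻¹) rfl h'.mdifferentiableAt
    ((Units.contMDiff_val (n := ∞)).contMDiffAt.mdifferentiableAt (by simp)) w).trans ?_
  set u := modelDeriv 𝓘(ℝ, ℂ) 𝓘(ℝ, ℂ) (Units.val : ℂˣ → ℂ) z w
  refine (congrArg (fun T : ℂ →L[ℝ] ℂ => T u) h'.mfderiv).trans ?_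
  change u * (c * -((z : ℂ) ^ 2)⁻¹) = _
  have := z.ne_zero
  field_simp

variable {E : Type*} [NormedAddCommGroup E] [NormedSpace ℝ E]
  {H : Type*} [TopologicalSpace H] {I : ModelWithCorners ℝ E H}
  {G : Type*} [TopologicalSpace G] [ChartedSpace H G] [Group G] [LieGroup I ∞ G]
  {η : LieDual E} {Λ : isotropy I G η →ₜ* Circle}

theorem mfderiv_sharp_quot {σ : Sec Λ} (hσ : σ ∈ SmoothSec Λ) (g : G) (z : ℂˣ) (V : E) (w : ℂ) :
    modelDeriv (I.prod 𝓘(ℝ, ℂ)) 𝓘(ℝ, ℂ) (fun x : G × ℂˣ => sharp Λ σ (quot Λ x)) (g, z) (V, w)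
      = (z : ℂ)⁻¹ * modelDeriv I 𝓘(ℝ, ℂ) (coordinate σ) g V
        - coordinate σ g * (z : ℂ)⁻¹ * (z : ℂ)⁻¹
          * modelDeriv 𝓘(ℝ, ℂ) 𝓘(ℝ, ℂ) (Units.val : ℂˣ → ℂ) z w := by
  have hsm : ContMDiff (I.prod 𝓘(ℝ, ℂ)) 𝓘(ℝ, ℂ) ∞ fun x : G × ℂˣ => sharp Λ σ (quot Λ x) := hσ
  -- The derivative of `s(g) / z` is the sum of its partial derivatives in `g` and in `z`.
  have h := mfderiv_prod_eq_add_apply (p := (g, z)) (v := (V, w))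
    (hsm.contMDiffAt.mdifferentiableAt (by simp))
  have e1 : (fun a : G => sharp Λ σ (quot Λ (a, z))) = fun a => (z : ℂ)⁻¹ * coordinate σ a :=
    funext fun a => (sharp_quot σ a z).trans (mul_comm _ _)
  have e2 : (fun b : ℂˣ => sharp Λ σ (quot Λ (g, b))) = fun b : ℂˣ => coordinate σ g * (b : ℂ)⁻¹ :=
    funext fun b => sharp_quot σ g b
  have h1 : modelDeriv I 𝓘(ℝ, ℂ) (fun a : G => sharp Λ σ (quot Λ (a, z))) g V
      = (z : ℂ)⁻¹ * modelDeriv I 𝓘(ℝ, ℂ) (coordinate σ) g V := by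
    rw [e1]
    exact modelDeriv_const_mul ((mem_smoothSec_iff.1 hσ).contMDiffAt.mdifferentiableAt (by simp)) _ _
  have h2 := modelDeriv_const_mul_units_inv (coordinate σ g) z w
  rw [← e2] at h2
  have h' : modelDeriv (I.prod 𝓘(ℝ, ℂ)) 𝓘(ℝ, ℂ) (fun x : G × ℂˣ => sharp Λ σ (quot Λ x)) (g, z)
      (V, w) = modelDeriv I 𝓘(ℝ, ℂ) (fun a : G => sharp Λ σ (quot Λ (a, z))) g V
        + modelDeriv 𝓘(ℝ, ℂ) 𝓘(ℝ, ℂ) (fun b : ℂˣ => sharp Λ σ (quot Λ (g, b))) z w := h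
  rw [h', h1, h2]
  ring

/-- The function of `D_{X_A} σ`, for `s` the function of `σ`. -/
def covariantCoordinate (η : LieDual E) (A : GroupLieAlgebra I G) (s : G → ℂ) (g : G) : ℂ :=
  rightInvariantDeriv A s g + 2 * Real.pi * Complex.I * ((coAd I g η A : ℝ) : ℂ) * s g

theorem covariantCoordinate_mul_inv (A : GroupLieAlgebra I G) {s : G → ℂ}
    (hs : ContMDiff I 𝓘(ℝ, ℂ) ∞ s)
    (hs' : ∀ (g : G) (b : isotropy I G η), s (g * (b : G)⁻¹) = (Λ b : ℂ) * s g)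
    (g : G) (b : isotropy I G η) :
    covariantCoordinate η A s (g * (b : G)⁻¹) = (Λ b : ℂ) * covariantCoordinate η A s g := by
  have h : coAd I (g * (b : G)⁻¹) η = coAd I g η := congrArg Subtype.val (orbitMap_mul_inv g b)
  have h2 := rightInvariantDeriv_mul_inv (show E from A) hs hs' g b
  rw [covariantCoordinate, covariantCoordinate, h, hs']
  linear_combination h2

/-- Horizontality determines the component along `ℂˣ`. -/
theorem connectionForm_eq_zero_iff (g : G) (z : ℂˣ) (V : E) (w : ℂ) :
    connectionForm (I := I) η g z V w = 0 ↔
      modelDeriv 𝓘(ℝ, ℂ) 𝓘(ℝ, ℂ) (Units.val : ℂˣ → ℂ) z w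
        = -(2 * Real.pi * Complex.I * ((η (modelDeriv I I (fun a : G => g⁻¹ * a) g V) : ℝ) : ℂ))
          * z := by
  set u := modelDeriv 𝓘(ℝ, ℂ) 𝓘(ℝ, ℂ) (Units.val : ℂˣ → ℂ) z w
  set r : ℂ := ((η (modelDeriv I I (fun a : G => g⁻¹ * a) g V) : ℝ) : ℂ)
  have h : connectionForm (I := I) η g z V w
      = r + (2 * Real.pi * Complex.I)⁻¹ * ((z : ℂ)⁻¹ * u) := rfl
  rw [h]
  have hz := z.ne_zero
  have hp := Complex.two_pi_I_ne_zero
  generalize (2 * Real.pi * Complex.I : ℂ) = q at hp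
  field_simp
  constructor
  · intro h
    linear_combination h
  · intro h
    linear_combination h

/-- Every point of `L^×` has a horizontal lift, so the condition defining `D_{X_A} σ` is never
vacuous; uniqueness rests on this. -/
theorem exists_isHorizontalLift (A : GroupLieAlgebra I G) (g : G) (z : ℂˣ) :
    ∃ w, IsHorizontalLift (fundamentalField I η A) g z (rightInvariantField A g) w := by
  obtain ⟨w, hw⟩ := modelDeriv_units_val_surjective z (-(2 * Real.pi * Complex.I *
    ((η (modelDeriv I I (fun a : G => g⁻¹ * a) g (show E from rightInvariantField A g)) : ℝ) : ℂ))
      * z)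
  exact ⟨w, orbitMapDeriv_mul_right η g A, (connectionForm_eq_zero_iff g z _ w).2 hw⟩

/-- The derivative of `σ^♯` along the horizontal lifts of `X_A`. -/
theorem mfderiv_sharp_of_isHorizontalLift [CompleteSpace E] [I.Boundaryless]
    (hΛ : HasDifferential Λ) {σ : Sec Λ} (hσ : σ ∈ SmoothSec Λ) (A : GroupLieAlgebra I G)
    (g : G) (z : ℂˣ) (V : E) (w : ℂ)
    (h : IsHorizontalLift (I := I) (fundamentalField I η A) g z V w) :
    modelDeriv (I.prod 𝓘(ℝ, ℂ)) 𝓘(ℝ, ℂ) (fun x : G × ℂˣ => sharp Λ σ (quot Λ x)) (g, z) (V, w)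
      = covariantCoordinate η A (coordinate σ) g * (z : ℂ)⁻¹ := by
  have h1 := modelDeriv_add_of_orbitMapDeriv_eq hΛ (mem_smoothSec_iff.1 hσ) (coordinate_mul_inv σ)
    A g V h.1
  have h2 := (connectionForm_eq_zero_iff g z V w).1 h.2
  rw [mfderiv_sharp_quot hσ, h2]
  have hz : (z : ℂ)⁻¹ * z = 1 := inv_mul_cancel₀ z.ne_zero
  have h1' := congrArg (fun x => x * (z : ℂ)⁻¹) h1
  refine Eq.trans ?_ h1'
  linear_combination (coordinate σ g * (z : ℂ)⁻¹ * (2 * Real.pi * Complex.I *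
    ((η (modelDeriv I I (fun a : G => g⁻¹ * a) g V) : ℝ) : ℂ))) * hz

/-- One lift over each `g`, at `z = 1`, already determines `τ`. Conversely all lifts are consistent,
by `mfderiv_sharp_of_isHorizontalLift`. -/
theorem isCovariantDerivative_iff [CompleteSpace E] [I.Boundaryless] (hΛ : HasDifferential Λ)
    {σ : Sec Λ} (hσ : σ ∈ SmoothSec Λ) (A : GroupLieAlgebra I G) (τ : Sec Λ) :
    IsCovariantDerivative Λ (fundamentalField I η A) σ τ ↔
      coordinate τ = covariantCoordinate η A (coordinate σ) := by
  constructor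
  · intro h
    funext g
    obtain ⟨w, hw⟩ := exists_isHorizontalLift (η := η) A g 1
    have h1 := (h g 1 _ w hw).trans (mfderiv_sharp_of_isHorizontalLift hΛ hσ A g 1 _ w hw)
    rw [sharp_quot] at h1
    simpa using h1
  · intro h g z V w hw
    rw [sharp_quot, h]
    exact (mfderiv_sharp_of_isHorizontalLift hΛ hσ A g z V w hw).symm

theorem existsUnique_isCovariantDerivative [CompleteSpace E] [I.Boundaryless]
    (hΛ : HasDifferential Λ) {σ : Sec Λ} (hσ : σ ∈ SmoothSec Λ) (A : GroupLieAlgebra I G) :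
    ∃! τ : Sec Λ, IsCovariantDerivative Λ (fundamentalField I η A) σ τ := by
  -- The candidate function defines a section only because it is equivariant: `R_A s` is, and `(g ·
  -- η)(A)` is unchanged by `g ↦ g b⁻¹`.
  refine ⟨sectionOf Λ (covariantCoordinate η A (coordinate σ)),
    (isCovariantDerivative_iff hΛ hσ A _).2 (coordinate_sectionOf (covariantCoordinate_mul_inv A
      (mem_smoothSec_iff.1 hσ) (coordinate_mul_inv σ))), fun τ hτ => section_ext fun g => ?_⟩
  rw [(isCovariantDerivative_iff hΛ hσ A τ).1 hτ, coordinate_sectionOf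
    (covariantCoordinate_mul_inv A (mem_smoothSec_iff.1 hσ) (coordinate_mul_inv σ))]

theorem coordinate_prequantization [CompleteSpace E] [I.Boundaryless] (hΛ : HasDifferential Λ)
    {σ : Sec Λ} (hσ : σ ∈ SmoothSec Λ) (A : GroupLieAlgebra I G) (g : G) :
    coordinate (prequantization Λ A σ) g = -rightInvariantDeriv A (coordinate σ) g := by
  have hex := existsUnique_isCovariantDerivative hΛ hσ A
  have hD : IsCovariantDerivative Λ (fundamentalField I η A) σ
      (covariantDerivative Λ (fundamentalField I η A) σ) := by
    rw [covariantDerivative, dif_pos hex]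
    exact hex.choose_spec.1
  have hc := congrFun ((isCovariantDerivative_iff hΛ hσ A _).1 hD) g
  -- Written as a linear combination of sections, so that the linearity of `sharp` applies.
  have e : prequantization Λ A σ (orbitMap I η g)
      = ((-1 : ℂ) • covariantDerivative Λ (fundamentalField I η A) σ +
        (-(2 * Real.pi * Complex.I * ((hamiltonian I η A (orbitMap I η g) : ℝ) : ℂ))) • σ)
          (orbitMap I η g) := by
    rw [Pi.add_apply, Pi.smul_apply, Pi.smul_apply, neg_smul, neg_smul, one_smul, ← sub_eq_add_neg]
    rfl
  refine (coordinate_eq_of_eq_pt (e.trans (section_orbitMap _ g))).trans ?_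
  refine (sharp_add Λ _ _ _).trans ?_
  rw [sharp_smul, sharp_smul]
  change -1 * coordinate (covariantDerivative Λ (fundamentalField I η A) σ) g
    + _ * coordinate σ g = _
  have hh : hamiltonian I η A (orbitMap I η g) = -(coAd I g η A) := rfl
  rw [hc, covariantCoordinate, hh]
  push_cast
  ring

end Connection

end CoadjointOrbit

end

theorem mainTheorem5
    {E : Type*} [NormedAddCommGroup E] [NormedSpace ℝ E] [FiniteDimensional ℝ E]
    {H : Type*} [TopologicalSpace H] (I : ModelWithCorners ℝ E H) [I.Boundaryless]
    {G : Type*} [TopologicalSpace G] [ChartedSpace H G] [Group G] [LieGroup I ∞ G]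
    [CompactSpace G] [T2Space G]
    (η : CoadjointOrbit.LieDual E)
    (Λ : CoadjointOrbit.isotropy I G η →ₜ* Circle)
    (hΛ : CoadjointOrbit.HasDifferential Λ) :
    ∃ Φ : CoadjointOrbit.SmoothSec Λ ≃ₗ[ℂ] CoadjointOrbit.EquivariantFunctions Λ,
      (∀ (σ : CoadjointOrbit.SmoothSec Λ) (g : G),
        (σ : CoadjointOrbit.Sec Λ) (CoadjointOrbit.orbitMap I η g)
          = CoadjointOrbit.pt Λ g ((Φ σ : G → ℂ) g)) ∧
      (∀ (A : GroupLieAlgebra I G) (σ : CoadjointOrbit.SmoothSec Λ),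
        ∃! τ : CoadjointOrbit.Sec Λ, CoadjointOrbit.IsCovariantDerivative Λ
          (CoadjointOrbit.fundamentalField I η A) (σ : CoadjointOrbit.Sec Λ) τ) ∧
      ∃ P : GroupLieAlgebra I G → Module.End ℂ (CoadjointOrbit.SmoothSec Λ),
        (∀ (A : GroupLieAlgebra I G) (σ : CoadjointOrbit.SmoothSec Λ),
          (P A σ : CoadjointOrbit.Sec Λ) = CoadjointOrbit.prequantization Λ A σ) ∧
        ∀ (A : GroupLieAlgebra I G) (s : CoadjointOrbit.EquivariantFunctions Λ) (g : G),
          (Φ (P A (Φ.symm s)) : G → ℂ) g = -CoadjointOrbit.rightInvariantDeriv A (s : G → ℂ) g := by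
  have : CompleteSpace E := FiniteDimensional.complete ℝ E
  let Φ := CoadjointOrbit.sectionEquiv Λ
  let P : GroupLieAlgebra I G → Module.End ℂ (CoadjointOrbit.SmoothSec Λ) := fun A =>
    -- Transporting `-R_A` through `Φ` makes linearity and smoothness automatic; agreement with
    -- `prequantization` is then checked on functions on `G`.
    (Φ.symm.toLinearMap ∘ₗ (-CoadjointOrbit.rightInvariantEnd Λ A)) ∘ₗ Φ.toLinearMap
  have hP (A : GroupLieAlgebra I G) (σ : CoadjointOrbit.SmoothSec Λ) :
      Φ (P A σ) = -CoadjointOrbit.rightInvariantEnd Λ A (Φ σ) := Φ.apply_symm_apply _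
  refine ⟨Φ, fun σ g => CoadjointOrbit.section_orbitMap σ.1 g,
    fun A σ => CoadjointOrbit.existsUnique_isCovariantDerivative hΛ σ.2 A, P, fun A σ => ?_,
    fun A s g => ?_⟩
  · refine CoadjointOrbit.section_ext fun g => ?_
    rw [CoadjointOrbit.coordinate_prequantization hΛ σ.2 A g]
    exact congrArg (fun s : CoadjointOrbit.EquivariantFunctions Λ => s.1 g) (hP A σ)
  · rw [hP, Φ.apply_symm_apply]
    rfl
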